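/- Let $\mathbf s=\{s_j\}_{j\ge 0}$ be a real sequence, $S_n=(s_{i+j})_{i,j=0}^{n-1}$, $S_n^+=(s_{i+j+1})_{i,j=0}^{n-1}$, and let $n_1<n_2<\dots$ be its normal indices, i.e. the integers $n\ge1$ with $\det S_n\neq0$. Let $\kappa,k\in\mathbb Z_+$ and assume $\mathbf s\in\mathcal H_\kappa^{k,reg}$, that is: for all sufficiently large $n$ the matrices $S_n$ and $S_n^+$ have exactly $\kappa$ and $k$ negative eigenvalues (counted with multiplicity), respectively, and $\det S_{n_j}^+\ne0$ for every normal index $n_j$. Let $(a_i,b_i)$ be the atoms of the P-fraction of the formal series $F_0(z)=-\sum_{j\ge0}s_jz^{-(j+1)}$: the monic polynomials $a_i$ and numbers $b_i\neq0$ determined by $F_i=-b_i/(a_i(z)+F_{i+1})$, $i=0,1,\dots$, where each $F_{i+1}$ is a formal series in negative powers of $z$ only (the expansion stops if some $F_i=0$). Let $P_j,Q_j$ be the Lanczos polynomials, i.e. the solutions of $b_jy_{j-1}-a_jy_j+y_{j+1}=0$ ($j\ge0$) with $P_{-1}=0$, $P_0=1$, $Q_{-1}=-1$, $Q_0=0$,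 put $\widetilde b_i=b_0b_1\cdots b_i$, and let $$P^+_{2j-1}(z)=-\frac{1}{\widetilde b_{j-1}}\begin{vmatrix}P_j(z)&P_{j-1}(z)\\P_j(0)&P_{j-1}(0)\end{vmatrix},\qquad Q^+_{2j-1}(z)=\frac{1}{\widetilde b_{j-1}}\begin{vmatrix}Q_j(z)&Q_{j-1}(z)\\P_j(0)&P_{j-1}(0)\end{vmatrix}$$ be the generalized Stieltjes polynomials of odd index of the first and second kind. An $[L/M]$ Padé approximant of $-\sum_{j\ge0}s_jz^{-(j+1)}$ is a rational function $f(z)=A(1/z)/B(1/z)$ with polynomials $A,B$ such that $\deg A\le L$, $\deg B\le M$, $B(0)\ne0$ and $$f(z)+\sum_{j=0}^{L+M}\frac{s_j}{z^{j+1}}=O\!\left(\frac1{z^{L+M+1}}\right)\qquad(z\to\infty\text{ nontangentially, i.e. in each sector } \varepsilon<\arg z<\pi-\varepsilon,\ \varepsilon>0).$$ Then for every $j\ge1$ for which $n_j$ exists, $P^+_{2j-1}\not\equiv0$, the $[n_j/n_j-1]$ Padé approximant of $-\sum_{i\ge0}s_iz^{-(i+1)}$ exists and is unique as a rational function, and $$f^{[n_j/n_j-1]}(z)=\frac{Q^+_{2j-1}(z)}{P^+_{2j-1}(z)}.$$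 -/

import Mathlib

open Polynomial

noncomputable section

namespace StieltjesPade

/-! ### Hankel matrices, normal indices and the classes of sequences -/

/-- The Hankel matrix `S_n = (s_{i+j})_{i,j=0}^{n-1}`. -/
def hankel (s : ℕ → ℝ) (n : ℕ) : Matrix (Fin n) (Fin n) ℝ :=
  Matrix.of fun i j => s ((i : ℕ) + (j : ℕ))

/-- The shifted sequence `{s_{j+1}}`; its Hankel matrices are `S_n^+ = (s_{i+j+1})`. -/
def shift (s : ℕ → ℝ) : ℕ → ℝ := fun j => s (j + 1)

theorem hankel_isHermitian (s : ℕ → ℝ) (n : ℕ) : (hankel s n).IsHermitian := by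
  ext i j
  simp [hankel, add_comm]

/-- `ν_-(S_n)`: the number of negative eigenvalues of `S_n`, counted with multiplicity. -/
def negIndex (s : ℕ → ℝ) (n : ℕ) : ℕ :=
  Nat.card {i : Fin n // (hankel_isHermitian s n).eigenvalues i < 0}

/-- The class `H_κ`: `ν_-(S_n) = κ` for all `n` big enough. -/
def ClassH (κ : ℕ) (s : ℕ → ℝ) : Prop :=
  ∀ᶠ n in Filter.atTop, negIndex s n = κ

/-- `n ∈ ℕ = {1, 2, …}` is a normal index of `s` if `D_n = det S_n ≠ 0`. -/
def IsNormalIndex (s : ℕ → ℝ) (n : ℕ) : Prop :=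
  1 ≤ n ∧ (hankel s n).det ≠ 0

/-- `n = n_j`, where `n_1 < n_2 < …` are the normal indices of `s` in increasing order. -/
def IsNthNormalIndex (s : ℕ → ℝ) (j n : ℕ) : Prop :=
  IsNormalIndex s n ∧ {m : ℕ | IsNormalIndex s m ∧ m ≤ n}.ncard = j

/-- The class `H_κ^{k,reg}`: `s ∈ H_κ`, `{s_{j+1}} ∈ H_k`, and `D_n^+ = det S_n^+ ≠ 0` for every
normal index `n` of `s`. -/
def ClassHReg (κ k : ℕ) (s : ℕ → ℝ) : Prop :=
  ClassH κ s ∧ ClassH k (shift s) ∧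
    ∀ n, IsNormalIndex s n → (hankel (shift s) n).det ≠ 0

/-! ### The P-fraction of `s`

Formal Laurent series at `z = ∞` are elements of `LaurentSeries ℝ`, the series variable being
`w = 1/z`. -/

/-- The series `-∑_{j ≥ 0} s_j / z^{j+1}`. -/
def momentSeries (s : ℕ → ℝ) : LaurentSeries ℝ :=
  -HahnSeries.ofPowerSeries ℤ ℝ (PowerSeries.X * PowerSeries.mk s)

/-- The variable `z = w⁻¹`. -/
def zSeries : LaurentSeries ℝ := HahnSeries.single (-1 : ℤ) 1

/-- The polynomial part (in `z`) of a Laurent series at infinity, constant term included. -/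
def polyPart (G : LaurentSeries ℝ) : ℝ[X] :=
  ∑ i ∈ Finset.range ((-G.order).toNat + 1), monomial i (G.coeff (-(i : ℤ)))

/-- For a series `F = -b z^{-ℓ} + …` the number `b`. -/
def headB (F : LaurentSeries ℝ) : ℝ := -F.leadingCoeff

/-- The polynomial part `a` of `-b / F`. It is monic if `F ≠ 0` and `F` vanishes at infinity. -/
def headA (F : LaurentSeries ℝ) : ℝ[X] :=
  polyPart (HahnSeries.C (-headB F) * F⁻¹)

/-- The remainders of the P-fraction expansion of `-∑ s_j / z^{j+1}`: `F_0` is the series itself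
and `F_i = -b_i / (a_i(z) + F_{i+1})`, where `F_{i+1}` has no polynomial part. When the expansion
terminates (some `F_i = 0`), the later remainders and atoms are set to `0`. -/
def remainder (s : ℕ → ℝ) : ℕ → LaurentSeries ℝ
  | 0 => momentSeries s
  | i + 1 =>
      HahnSeries.C (-headB (remainder s i)) * (remainder s i)⁻¹ -
        aeval zSeries (headA (remainder s i))

/-- The polynomial `a_i` of the `i`-th atom `(a_i, b_i)` of the P-fraction
`-b_0 / (a_0(z) - b_1 / (a_1(z) - …))` of `s`. -/
def atomA (s : ℕ → ℝ) (i : ℕ) : ℝ[X] := headA (remainder s i)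

/-- The number `b_i` of the `i`-th atom `(a_i, b_i)`. -/
def atomB (s : ℕ → ℝ) (i : ℕ) : ℝ := headB (remainder s i)

/-! ### Lanczos polynomials and generalized Stieltjes polynomials -/

/-- The solution of `b_j y_{j-1} - a_j y_j + y_{j+1} = 0` (`j ≥ 0`) with `y_{-1} = u`, `y_0 = v`.
The index is shifted by one: the value at `j` is `y_{j-1}`. -/
def recSol (s : ℕ → ℝ) (u v : ℝ[X]) : ℕ → ℝ[X]
  | 0 => u
  | 1 => v
  | j + 2 => atomA s j * recSol s u v (j + 1) - C (atomB s j) * recSol s u v j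

/-- Lanczos polynomials of the first kind: `P_{-1} = 0`, `P_0 = 1`. -/
def lanczosP (s : ℕ → ℝ) (j : ℕ) : ℝ[X] := recSol s 0 1 (j + 1)

/-- Lanczos polynomials of the second kind: `Q_{-1} = -1`, `Q_0 = 0`. -/
def lanczosQ (s : ℕ → ℝ) (j : ℕ) : ℝ[X] := recSol s (-1) 0 (j + 1)

/-- `b̃_i = b_0 b_1 ⋯ b_i`. -/
def bTilde (s : ℕ → ℝ) (i : ℕ) : ℝ := ∏ r ∈ Finset.range (i + 1), atomB s r

/-- Generalized Stieltjes polynomials of the first kind `P^+_n`, `n ≥ 0`: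
`P^+_{2i} = P_i / P_i(0)` and, with `n = 2i - 1` (so that `i = n / 2 + 1`, `i - 1 = n / 2`),
`P^+_{2i-1} = -(1 / b̃_{i-1}) (P_i P_{i-1}(0) - P_{i-1} P_i(0))`. -/
def stieltjesP (s : ℕ → ℝ) (n : ℕ) : ℝ[X] :=
  if Even n then C ((lanczosP s (n / 2)).eval 0)⁻¹ * lanczosP s (n / 2)
  else -C (bTilde s (n / 2))⁻¹ *
    Matrix.det !![lanczosP s (n / 2 + 1), lanczosP s (n / 2);
      C ((lanczosP s (n / 2 + 1)).eval 0), C ((lanczosP s (n / 2)).eval 0)]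

/-- Generalized Stieltjes polynomials of the second kind `Q^+_n`, `n ≥ 0`:
`Q^+_{2i} = -Q_i / P_i(0)` and
`Q^+_{2i-1} = (1 / b̃_{i-1}) (Q_i P_{i-1}(0) - Q_{i-1} P_i(0))`. -/
def stieltjesQ (s : ℕ → ℝ) (n : ℕ) : ℝ[X] :=
  if Even n then -C ((lanczosP s (n / 2)).eval 0)⁻¹ * lanczosQ s (n / 2)
  else C (bTilde s (n / 2))⁻¹ *
    Matrix.det !![lanczosQ s (n / 2 + 1), lanczosQ s (n / 2);
      C ((lanczosP s (n / 2 + 1)).eval 0), C ((lanczosP s (n / 2)).eval 0)]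

/-- A real polynomial as a rational function over `ℂ`. -/
def toRat (p : ℝ[X]) : RatFunc ℂ :=
  algebraMap ℂ[X] (RatFunc ℂ) (p.map (algebraMap ℝ ℂ))

/-! ### Padé approximants -/

/-- The filter "`z → ∞` inside the sector `ε < arg z < π - ε`". -/
def sectorAtInfty (ε : ℝ) : Filter ℂ :=
  Bornology.cobounded ℂ ⊓
    Filter.principal {z : ℂ | ε < Complex.arg z ∧ Complex.arg z < Real.pi - ε}

/-- The rational function `f` is an `[L/M]` Padé approximant of `-∑ s_j / z^{j+1}`:
`f(z) = A(1/z) / B(1/z)` with polynomials `A`, `B` of formal degree `L`, `M`, `B(0) ≠ 0`, and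
`f(z) + ∑_{j=0}^{L+M} s_j / z^{j+1} = O(1 / z^{L+M+1})` as `z → ∞` nontangentially. -/
def IsPade (s : ℕ → ℝ) (L M : ℕ) (f : RatFunc ℂ) : Prop :=
  (∃ A B : ℂ[X], A.natDegree ≤ L ∧ B.natDegree ≤ M ∧ B.eval 0 ≠ 0 ∧
      f = aeval (RatFunc.X : RatFunc ℂ)⁻¹ A / aeval (RatFunc.X : RatFunc ℂ)⁻¹ B) ∧
    ∀ ε : ℝ, 0 < ε →
      (fun z : ℂ => f.eval (RingHom.id ℂ) z +
          ∑ j ∈ Finset.range (L + M + 1), (s j : ℂ) / z ^ (j + 1))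
        =O[sectorAtInfty ε] fun z : ℂ => 1 / z ^ (L + M + 1)

end StieltjesPade

end

noncomputable section

namespace StieltjesPade

/-! ### Polynomials inside the Laurent series at infinity -/

/-! Put `w = 1/z` and `E_j = P_j F_0 + Q_j`. The P-fraction relation gives `E_j = -F_j E_{j-1}`, so
`E_j` is, up to sign, the product of the remainders `F_0, …, F_j`, and orders in `w` add up:
`E_{j-1}` vanishes to order at least `deg a_0 + … + deg a_{j-1} = deg P_j` (`linError_succ`,
`le_orderTop_linError`).

These degree sums are exactly the normal indices. A kernel vector of `S_m` is a polynomial `p` of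
degree below `m` for which `p F_0` has no terms `w, …, w^m`. Strictly between two degree sums, or
past the end of a terminating expansion, a Lanczos polynomial is such a `p`; at a degree sum the
constant Wronskian of `P` and `Q` excludes one. Hence `n_j = deg P_j`
(`IsNthNormalIndex.eq_degSum`).

Up to a constant, `P^+_{2j-1}` is the combination of `P_j` and `P_{j-1}` that vanishes at 0, and
`P^+ F_0 - Q^+` is the same combination of `E_j` and `E_{j-1}`, hence of order at least `n_j`.
Regularity gives `P_{j-1}(0) ≠ 0`, so `P^+` has exact degree `n_j`. Reversing coefficients yields
`A(w)/B(w)` with `B(0) ≠ 0`; the zero of `P^+` at 0 lowers `deg B` to `n_j - 1`, and the error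
becomes `O(w^{2 n_j})`. Uniqueness is the usual cross-multiplication argument (`isPade_unique`). -/

theorem le_orderTop_iff {x : LaurentSeries ℝ} {m : ℤ} :
    (m : WithTop ℤ) ≤ x.orderTop ↔ ∀ k < m, x.coeff k = 0 := by
  simp [HahnSeries.le_orderTop_iff_forall]

theorem le_orderTop_mul {x y : LaurentSeries ℝ} {m n : ℤ} (hx : (m : WithTop ℤ) ≤ x.orderTop)
    (hy : (n : WithTop ℤ) ≤ y.orderTop) : ((m + n : ℤ) : WithTop ℤ) ≤ (x * y).orderTop := by
  rw [WithTop.coe_add]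
  exact (add_le_add hx hy).trans HahnSeries.orderTop_add_le_mul

theorem le_orderTop_sub {x y : LaurentSeries ℝ} {m : WithTop ℤ} (hx : m ≤ x.orderTop)
    (hy : m ≤ y.orderTop) : m ≤ (x - y).orderTop :=
  (le_min hx hy).trans HahnSeries.min_orderTop_le_orderTop_sub

theorem algebraMap_laurent (r : ℝ) : algebraMap ℝ (LaurentSeries ℝ) r = HahnSeries.C r := by
  rw [HahnSeries.algebraMap_apply', PowerSeries.algebraMap_apply, Algebra.algebraMap_self,
    RingHom.id_apply, HahnSeries.ofPowerSeries_C]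

theorem zSeries_pow (k : ℕ) : zSeries ^ k = HahnSeries.single (-(k : ℤ)) (1 : ℝ) := by
  simp [zSeries]

theorem coeff_aeval_zSeries_mul (p : ℝ[X]) (F : LaurentSeries ℝ) (m : ℤ) :
    (aeval zSeries p * F).coeff m = p.sum fun k c => c * F.coeff (m + k) := by
  rw [aeval_eq_sum_range, Finset.sum_mul, HahnSeries.coeff_sum,
    p.sum_over_range (by simp)]
  refine Finset.sum_congr rfl fun k _ => ?_
  rw [zSeries_pow, Algebra.smul_def, algebraMap_laurent, mul_assoc, HahnSeries.C_mul_eq_smul,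
    HahnSeries.coeff_smul, HahnSeries.coeff_single_mul, sub_neg_eq_add, one_mul, smul_eq_mul]

theorem coeff_aeval_zSeries_neg (p : ℝ[X]) (i : ℕ) :
    (aeval zSeries p).coeff (-(i : ℤ)) = p.coeff i := by
  have h := coeff_aeval_zSeries_mul p 1 (-(i : ℤ))
  rw [mul_one] at h
  rw [h, Polynomial.sum_def, Finset.sum_eq_single i]
  · simp
  · intro k _ hk
    rw [HahnSeries.coeff_one, if_neg (by omega), mul_zero]
  · simp

theorem coeff_aeval_zSeries_pos (p : ℝ[X]) {m : ℤ} (hm : 0 < m) :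
    (aeval zSeries p).coeff m = 0 := by
  have h := coeff_aeval_zSeries_mul p 1 m
  rw [mul_one] at h
  rw [h, Polynomial.sum_def, Finset.sum_eq_zero]
  intro k _
  rw [HahnSeries.coeff_one, if_neg (by omega), mul_zero]

theorem le_orderTop_aeval_zSeries {p : ℝ[X]} {d : ℕ} (hp : p.natDegree ≤ d) :
    ((-(d : ℤ) : ℤ) : WithTop ℤ) ≤ (aeval zSeries p).orderTop := by
  rw [le_orderTop_iff]
  intro k hk
  obtain ⟨i, rfl⟩ : ∃ i : ℕ, k = -(i : ℤ) := ⟨(-k).toNat, by omega⟩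
  rw [coeff_aeval_zSeries_neg]
  exact coeff_eq_zero_of_natDegree_lt (by omega)

/-- A nonzero polynomial in `z` has order at most 0 in `w`. This turns order estimates into
polynomial identities. -/
theorem eq_zero_of_one_le_orderTop_aeval_zSeries {p : ℝ[X]}
    (hp : ((1 : ℤ) : WithTop ℤ) ≤ (aeval zSeries p).orderTop) : p = 0 := by
  ext i
  rw [← coeff_aeval_zSeries_neg, coeff_zero]
  exact le_orderTop_iff.1 hp _ (by omega)

theorem coeff_polyPart (G : LaurentSeries ℝ) (i : ℕ) :
    (polyPart G).coeff i = G.coeff (-(i : ℤ)) := by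
  simp only [polyPart, finsetSum_coeff, coeff_monomial]
  rw [Finset.sum_ite_eq' (Finset.range _) i]
  split_ifs with h
  · rfl
  · refine (HahnSeries.coeff_eq_zero_of_lt_order ?_).symm
    rw [Finset.mem_range] at h
    omega

theorem coeff_sub_polyPart_pos (G : LaurentSeries ℝ) {m : ℤ} (hm : 0 < m) :
    (G - aeval zSeries (polyPart G)).coeff m = G.coeff m := by
  rw [HahnSeries.coeff_sub, coeff_aeval_zSeries_pos _ hm, sub_zero]

theorem one_le_orderTop_sub_polyPart (G : LaurentSeries ℝ) :
    ((1 : ℤ) : WithTop ℤ) ≤ (G - aeval zSeries (polyPart G)).orderTop := by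
  rw [le_orderTop_iff]
  intro k hk
  obtain ⟨i, rfl⟩ : ∃ i : ℕ, k = -(i : ℤ) := ⟨(-k).toNat, by omega⟩
  rw [HahnSeries.coeff_sub, coeff_aeval_zSeries_neg, coeff_polyPart, sub_self]

theorem coeff_momentSeries (s : ℕ → ℝ) (i : ℕ) :
    (momentSeries s).coeff ((i : ℤ) + 1) = -s i := by
  have : ((i : ℤ) + 1) = ((i + 1 : ℕ) : ℤ) := by push_cast; rfl
  rw [momentSeries, HahnSeries.coeff_neg, this, HahnSeries.ofPowerSeries_apply_coeff,
    PowerSeries.coeff_succ_X_mul, PowerSeries.coeff_mk]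

theorem one_le_orderTop_momentSeries (s : ℕ → ℝ) :
    ((1 : ℤ) : WithTop ℤ) ≤ (momentSeries s).orderTop := by
  rw [momentSeries, HahnSeries.orderTop_neg, map_mul, HahnSeries.ofPowerSeries_X]
  have h0 : ((0 : ℤ) : WithTop ℤ) ≤
      (HahnSeries.ofPowerSeries ℤ ℝ (PowerSeries.mk s)).orderTop := by
    rw [le_orderTop_iff]
    intro k hk
    exact (PowerSeries.coeff_coe _ k).trans (if_pos hk)
  exact le_orderTop_mul (m := 1) (n := 0) HahnSeries.orderTop_single_le h0

/-! ### The P-fraction -/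

theorem one_le_orderTop_remainder (s : ℕ → ℝ) :
    ∀ i, ((1 : ℤ) : WithTop ℤ) ≤ (remainder s i).orderTop
  | 0 => one_le_orderTop_momentSeries s
  | _ + 1 => one_le_orderTop_sub_polyPart _

theorem headA_spec {F : LaurentSeries ℝ} (hF : F ≠ 0)
    (h1 : ((1 : ℤ) : WithTop ℤ) ≤ F.orderTop) :
    (headA F).Monic ∧ ((headA F).natDegree : ℤ) = F.order := by
  have hord : 1 ≤ F.order := by
    rw [← HahnSeries.order_eq_orderTop_of_ne_zero hF] at h1
    exact_mod_cast h1
  obtain ⟨d, hd⟩ : ∃ d : ℕ, (d : ℤ) = F.order := ⟨F.order.toNat, by omega⟩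
  set c := F.leadingCoeff with hc
  have hc0 : c ≠ 0 := HahnSeries.leadingCoeff_ne_zero.2 hF
  set G : LaurentSeries ℝ := HahnSeries.C (-headB F) * F⁻¹ with hG
  -- From `G F = c`, the order of `G` is minus that of `F` and its leading coefficient is 1.
  have hGF : G * F = HahnSeries.C c := by
    rw [hG, mul_assoc, inv_mul_cancel₀ hF, mul_one, headB, neg_neg]
  have hG0 : G ≠ 0 := by
    rintro h
    rw [h, zero_mul] at hGF
    exact HahnSeries.C_ne_zero hc0 hGF.symm
  have hGord : G.order = -(d : ℤ) := by
    have := congrArg HahnSeries.order hGF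
    rw [HahnSeries.order_mul hG0 hF, HahnSeries.order_C] at this
    omega
  have hGlead : G.leadingCoeff = 1 := by
    have := congrArg HahnSeries.leadingCoeff hGF
    rw [HahnSeries.leadingCoeff_mul, ← hc, HahnSeries.C_apply,
      HahnSeries.leadingCoeff_of_single] at this
    exact (mul_eq_right₀ hc0).1 this
  have hcoeff : (headA F).coeff d = 1 := by
    rw [headA, coeff_polyPart, ← hGord, ← HahnSeries.leadingCoeff_eq]
    exact hGlead
  have hdeg : (headA F).natDegree ≤ d := by
    rw [natDegree_le_iff_coeff_eq_zero]
    intro i hi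
    rw [headA, coeff_polyPart]
    exact HahnSeries.coeff_eq_zero_of_lt_order (by rw [← hG, hGord]; omega)
  have hdeg' : (headA F).natDegree = d :=
    natDegree_eq_of_le_of_coeff_ne_zero hdeg (by rw [hcoeff]; exact one_ne_zero)
  refine ⟨?_, by rw [hdeg', hd]⟩
  rw [Monic, leadingCoeff, hdeg', hcoeff]

theorem atomA_monic {s : ℕ → ℝ} {i : ℕ} (h : remainder s i ≠ 0) : (atomA s i).Monic :=
  (headA_spec h (one_le_orderTop_remainder s i)).1

theorem natDegree_atomA_pos {s : ℕ → ℝ} {i : ℕ} (h : remainder s i ≠ 0) :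
    0 < (atomA s i).natDegree := by
  have h1 := one_le_orderTop_remainder s i
  have h2 := (headA_spec h h1).2
  rw [← HahnSeries.order_eq_orderTop_of_ne_zero h, WithTop.coe_le_coe] at h1
  rw [atomA]
  omega

/-- Equality holds unless the remainder is 0, where the order is `⊤`; the inequality needs no case
distinction on termination. -/
theorem natDegree_atomA_le_orderTop (s : ℕ → ℝ) (i : ℕ) :
    (((atomA s i).natDegree : ℤ) : WithTop ℤ) ≤ (remainder s i).orderTop := by
  by_cases h : remainder s i = 0
  · rw [h, HahnSeries.orderTop_zero]
    exact le_top
  · rw [atomA, (headA_spec h (one_le_orderTop_remainder s i)).2,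
      HahnSeries.order_eq_orderTop_of_ne_zero h]

theorem atomB_ne_zero {s : ℕ → ℝ} {i : ℕ} (h : remainder s i ≠ 0) : atomB s i ≠ 0 :=
  neg_ne_zero.2 (HahnSeries.leadingCoeff_ne_zero.2 h)

theorem remainder_mul (s : ℕ → ℝ) (i : ℕ) :
    remainder s i * (aeval zSeries (atomA s i) + remainder s (i + 1)) =
      -HahnSeries.C (atomB s i) := by
  rw [remainder, ← atomA, add_sub_cancel, ← atomB]
  by_cases h : remainder s i = 0
  · simp [h, atomB, headB]
  · rw [mul_left_comm, mul_inv_cancel₀ h, mul_one, map_neg]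

/-- The sum of the degrees of the first `j` polynomials `a_i`. -/
def degSum (s : ℕ → ℝ) (j : ℕ) : ℕ := ∑ i ∈ Finset.range j, (atomA s i).natDegree

theorem degSum_succ (s : ℕ → ℝ) (j : ℕ) :
    degSum s (j + 1) = degSum s j + (atomA s j).natDegree :=
  Finset.sum_range_succ _ _

theorem degSum_mono (s : ℕ → ℝ) : Monotone (degSum s) :=
  monotone_nat_of_le_succ fun j => by rw [degSum_succ]; omega

/-- The linearized error `P_{j-1} F_0 + Q_{j-1}`. -/
def linError (s : ℕ → ℝ) (j : ℕ) : LaurentSeries ℝ :=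
  aeval zSeries (recSol s 0 1 j) * momentSeries s + aeval zSeries (recSol s (-1) 0 j)

theorem linError_succ (s : ℕ → ℝ) (j : ℕ) :
    linError s (j + 1) = -(remainder s j * linError s j) := by
  induction j with
  | zero =>
    simp [linError, recSol, remainder]
    ring
  | succ j ih =>
    have h : linError s (j + 2) = aeval zSeries (atomA s j) * linError s (j + 1) -
        HahnSeries.C (atomB s j) * linError s j := by
      simp only [linError, recSol, map_sub, map_mul, aeval_C, algebraMap_laurent]
      ring
    have h' := remainder_mul s j
    rw [h, ih]
    linear_combination (-linError s j) * h'

theorem le_orderTop_linError (s : ℕ → ℝ) (j : ℕ) :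
    ((degSum s j : ℤ) : WithTop ℤ) ≤ (linError s j).orderTop := by
  induction j with
  | zero => simp [degSum, linError, recSol]
  | succ j ih =>
    rw [linError_succ, HahnSeries.orderTop_neg, degSum_succ, add_comm, Nat.cast_add]
    exact le_orderTop_mul (natDegree_atomA_le_orderTop s j) ih

theorem linError_eq_zero {s : ℕ → ℝ} {j : ℕ} (h : remainder s j = 0) :
    linError s (j + 1) = 0 := by
  rw [linError_succ, h, zero_mul, neg_zero]

/-- Each step of the recurrence multiplies the Wronskian by `b_j`. -/
theorem recSol_wronskian (s : ℕ → ℝ) (j : ℕ) :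
    recSol s 0 1 (j + 1) * recSol s (-1) 0 j - recSol s (-1) 0 (j + 1) * recSol s 0 1 j =
      -C (∏ r ∈ Finset.range j, atomB s r) := by
  induction j with
  | zero => simp [recSol]
  | succ j ih =>
    rw [Finset.prod_range_succ, C_mul]
    simp only [recSol]
    linear_combination C (atomB s j) * ih

/-- The last bound is not strict because of `P_{-1} = 0` at `j = 0`; positivity of `deg a_j` still
makes `a_j P_j` dominate in the induction. -/
theorem recSol_first_degree {s : ℕ → ℝ} {j : ℕ} (h : ∀ i < j, remainder s i ≠ 0) :
    (recSol s 0 1 (j + 1)).Monic ∧ (recSol s 0 1 (j + 1)).natDegree = degSum s j ∧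
      (recSol s 0 1 j).natDegree ≤ degSum s j := by
  induction j with
  | zero => simp [recSol, degSum]
  | succ j ih =>
    obtain ⟨hm, hd, hd'⟩ := ih fun i hi => h i (hi.trans (Nat.lt_succ_self j))
    have hj := h j (Nat.lt_succ_self j)
    have ha := atomA_monic hj
    have hpos := natDegree_atomA_pos hj
    have hmul := ha.mul hm
    have hmuldeg : (atomA s j * recSol s 0 1 (j + 1)).natDegree = degSum s (j + 1) := by
      rw [ha.natDegree_mul hm, hd, degSum_succ, add_comm]
    have hlt : (C (atomB s j) * recSol s 0 1 j).natDegree <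
        (atomA s j * recSol s 0 1 (j + 1)).natDegree := by
      refine (natDegree_C_mul_le _ _).trans_lt ?_
      rw [hmuldeg, degSum_succ]
      omega
    refine ⟨?_, ?_, ?_⟩
    · exact hmul.sub_of_left (degree_lt_degree hlt)
    · rw [recSol, natDegree_sub_eq_left_of_natDegree_lt hlt, hmuldeg]
    · rw [hd, degSum_succ]
      omega

theorem natDegree_recSol_second_le (s : ℕ → ℝ) (j : ℕ) :
    (recSol s (-1) 0 (j + 1)).natDegree ≤ degSum s j ∧
      (recSol s (-1) 0 j).natDegree ≤ degSum s j := by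
  induction j with
  | zero => simp [recSol, degSum]
  | succ j ih =>
    have hle := degSum_mono s (Nat.le_succ j)
    refine ⟨?_, ih.1.trans hle⟩
    rw [recSol]
    refine (natDegree_sub_le _ _).trans (max_le ?_ <|
      (natDegree_C_mul_le _ _).trans (ih.2.trans hle))
    refine natDegree_mul_le.trans ?_
    rw [degSum_succ]
    omega

/-! ### Hankel determinants and normal indices -/

theorem coeff_aeval_mul_momentSeries (s : ℕ → ℝ) {p : ℝ[X]} {m : ℕ} (hp : p.natDegree < m)
    (i : ℕ) : (aeval zSeries p * momentSeries s).coeff ((i : ℤ) + 1) =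
      -∑ k : Fin m, s (i + k) * p.coeff k := by
  rw [coeff_aeval_zSeries_mul, p.sum_over_range' (by simp) m hp,
    Fin.sum_univ_eq_sum_range (fun k => s (i + k) * p.coeff k), ← Finset.sum_neg_distrib]
  refine Finset.sum_congr rfl fun k _ => ?_
  have : (i : ℤ) + 1 + k = ((i + k : ℕ) : ℤ) + 1 := by push_cast; ring
  rw [this, coeff_momentSeries]
  ring

theorem hankel_mulVec (s : ℕ → ℝ) (m : ℕ) (v : Fin m → ℝ) (i : Fin m) :
    (hankel s m).mulVec v i = ∑ k : Fin m, s (i + k) * v k := rfl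

/-- Kernel vectors of the Hankel matrix are read as coefficient lists of polynomials. -/
theorem hankel_det_eq_zero_iff (s : ℕ → ℝ) (m : ℕ) :
    (hankel s m).det = 0 ↔ ∃ p : ℝ[X], p ≠ 0 ∧ p.natDegree < m ∧
      ∀ i : ℕ, i < m → (aeval zSeries p * momentSeries s).coeff ((i : ℤ) + 1) = 0 := by
  rw [← Matrix.exists_mulVec_eq_zero_iff]
  constructor
  · rintro ⟨v, hv, hSv⟩
    obtain ⟨k₀, hk₀⟩ := Function.ne_iff.1 hv
    set p : ℝ[X] := ∑ k : Fin m, monomial (k : ℕ) (v k) with hp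
    have hcoeff : ∀ k : Fin m, p.coeff k = v k := by
      intro k
      simp only [hp, finsetSum_coeff, coeff_monomial, Fin.val_inj]
      rw [Finset.sum_ite_eq' Finset.univ k, if_pos (Finset.mem_univ k)]
    have hm : 0 < m := k₀.pos
    have hdeg : p.natDegree < m := by
      refine lt_of_le_of_lt (natDegree_sum_le_of_forall_le (n := m - 1) _ _ fun k _ => ?_)
        (Nat.sub_lt hm one_pos)
      exact (natDegree_monomial_le _).trans (by omega)
    refine ⟨p, fun h => hk₀ ?_, hdeg, fun i hi => ?_⟩
    · rw [← hcoeff, h, coeff_zero, Pi.zero_apply]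
    · have := congrFun hSv ⟨i, hi⟩
      rw [hankel_mulVec, Pi.zero_apply] at this
      rw [coeff_aeval_mul_momentSeries s hdeg]
      simp only [hcoeff]
      rw [this, neg_zero]
  · rintro ⟨p, hp, hdeg, h⟩
    refine ⟨fun k => p.coeff k, fun h0 => hp ?_, ?_⟩
    · exact leadingCoeff_eq_zero.1 (congrFun h0 ⟨p.natDegree, hdeg⟩)
    · ext i
      have := h i i.2
      rw [coeff_aeval_mul_momentSeries s hdeg, neg_eq_zero] at this
      rw [hankel_mulVec, this, Pi.zero_apply]

/-- The shifted series differs from `z F_0` by a constant, whose product with `p` is invisible in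
positive powers of `w`. -/
theorem coeff_aeval_mul_momentSeries_shift (s : ℕ → ℝ) (p : ℝ[X]) (i : ℕ) :
    (aeval zSeries p * momentSeries (shift s)).coeff ((i : ℤ) + 1) =
      (aeval zSeries (X * p) * momentSeries s).coeff ((i : ℤ) + 1) := by
  have h1 := coeff_aeval_mul_momentSeries (shift s) (Nat.lt_succ_self p.natDegree) i
  have h2 := coeff_aeval_mul_momentSeries s (Nat.lt_succ_self p.natDegree) (i + 1)
  push_cast at h2
  rw [h1, map_mul, aeval_X, mul_assoc]
  conv_rhs => rw [zSeries, HahnSeries.coeff_single_mul, one_mul, sub_neg_eq_add, ← zSeries, h2]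
  simp only [shift, add_right_comm]

/-- This is the orthogonality of `P_j` to all degrees below `deg P_j`. It survives termination,
where the error is 0. -/
theorem degSum_add_one_le_orderTop_linError (s : ℕ → ℝ) (j : ℕ) :
    ((degSum s j + 1 : ℤ) : WithTop ℤ) ≤ (linError s (j + 1)).orderTop := by
  by_cases h : remainder s j = 0
  · rw [linError_eq_zero h, HahnSeries.orderTop_zero]
    exact le_top
  · refine le_trans ?_ (le_orderTop_linError s (j + 1))
    have := natDegree_atomA_pos h
    rw [degSum_succ, WithTop.coe_le_coe]
    push_cast
    omega

theorem degSum_lt_degSum {s : ℕ → ℝ} {i j : ℕ} (hij : i < j) (h : ∀ r < j, remainder s r ≠ 0) :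
    degSum s i < degSum s j := by
  have h1 := degSum_mono s (Nat.succ_le_of_lt hij)
  have h2 := natDegree_atomA_pos (h i hij)
  rw [Nat.succ_eq_add_one, degSum_succ] at h1
  omega

theorem prod_atomB_ne_zero {s : ℕ → ℝ} {j : ℕ} (h : ∀ i < j, remainder s i ≠ 0) :
    ∏ r ∈ Finset.range j, atomB s r ≠ 0 :=
  Finset.prod_ne_zero_iff.2 fun i hi => atomB_ne_zero (h i (Finset.mem_range.1 hi))

theorem hankel_det_degSum_ne_zero {s : ℕ → ℝ} {j : ℕ} (h : ∀ i < j, remainder s i ≠ 0) :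
    (hankel s (degSum s j)).det ≠ 0 := by
  rw [Ne, hankel_det_eq_zero_iff]
  rintro ⟨p, hp, hdeg, hcoeff⟩
  obtain ⟨-, hPdeg, -⟩ := recSol_first_degree h
  set P := recSol s 0 1 (j + 1) with hP
  set Q := recSol s (-1) 0 (j + 1) with hQ
  set G := aeval zSeries p * momentSeries s with hG
  set E := G - aeval zSeries (polyPart G) with hE
  have hEord : ((degSum s j + 1 : ℤ) : WithTop ℤ) ≤ E.orderTop := by
    rw [le_orderTop_iff]
    intro k hk
    by_cases hk0 : 0 < k
    · rw [hE, coeff_sub_polyPart_pos _ hk0]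
      have := hcoeff (k - 1).toNat (by omega)
      rwa [show (((k - 1).toNat : ℤ) + 1) = k by omega] at this
    · exact le_orderTop_iff.1 (one_le_orderTop_sub_polyPart G) k (by omega)
  -- Eliminating `F_0` between `p F_0` and `P F_0 + Q` leaves a polynomial on the left and terms of
  -- positive order on the right.
  have hkey : aeval zSeries (p * Q + polyPart G * P) =
      aeval zSeries p * linError s (j + 1) - aeval zSeries P * E := by
    simp only [linError, ← hP, ← hQ, hE, hG, map_add, map_mul]
    ring
  have hzero : p * Q + polyPart G * P = 0 := by
    apply eq_zero_of_one_le_orderTop_aeval_zSeries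
    rw [hkey]
    refine le_orderTop_sub ?_ ?_
    · refine le_trans ?_ (le_orderTop_mul (le_orderTop_aeval_zSeries (le_refl p.natDegree))
        (degSum_add_one_le_orderTop_linError s j))
      rw [WithTop.coe_le_coe]
      omega
    · refine le_trans ?_ (le_orderTop_mul (le_orderTop_aeval_zSeries hPdeg.le) hEord)
      rw [WithTop.coe_le_coe]
      omega
  have hw := recSol_wronskian s j
  rw [← hP, ← hQ] at hw
  -- The Wronskian is a nonzero constant, so `P ∣ p Q` upgrades to `P ∣ p`, against `deg p < deg P`.
  have hdvd : P ∣ p * C (∏ r ∈ Finset.range j, atomB s r) := by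
    refine ⟨-(p * recSol s (-1) 0 j + polyPart G * recSol s 0 1 j), ?_⟩
    linear_combination p * hw + recSol s 0 1 j * hzero
  rw [(isUnit_C.2 (isUnit_iff_ne_zero.2 (prod_atomB_ne_zero h))).dvd_mul_right] at hdvd
  have := natDegree_le_of_dvd hdvd hp
  omega

theorem hankel_det_eq_zero_of_gap {s : ℕ → ℝ} {j m : ℕ} (h : ∀ i < j, remainder s i ≠ 0)
    (hm : degSum s j < m) (hgap : remainder s j = 0 ∨ m < degSum s (j + 1)) :
    (hankel s m).det = 0 := by
  obtain ⟨hmonic, hPdeg, -⟩ := recSol_first_degree h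
  rw [hankel_det_eq_zero_iff]
  refine ⟨_, hmonic.ne_zero, hPdeg.trans_lt hm, fun i hi => ?_⟩
  have hord : ((m + 1 : ℤ) : WithTop ℤ) ≤ (linError s (j + 1)).orderTop := by
    rcases hgap with h0 | hlt
    · rw [linError_eq_zero h0, HahnSeries.orderTop_zero]
      exact le_top
    · refine le_trans ?_ (le_orderTop_linError s (j + 1))
      rw [WithTop.coe_le_coe]
      omega
  have := le_orderTop_iff.1 hord ((i : ℤ) + 1) (by omega)
  rwa [linError, HahnSeries.coeff_add, coeff_aeval_zSeries_pos _ (by omega), add_zero] at this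

theorem exists_eq_degSum {s : ℕ → ℝ} {n : ℕ} (hn : IsNormalIndex s n) :
    ∃ j, n = degSum s j ∧ ∀ i < j, remainder s i ≠ 0 := by
  by_contra! hcon
  -- An `n` that is not a degree sum stays above all of them, yet each step raises the sum by at
  -- least 1; `j = n` is then absurd.
  have key : ∀ j, (∀ i < j, remainder s i ≠ 0) ∧ degSum s j < n ∧ j ≤ degSum s j := by
    intro j
    induction j with
    | zero => exact ⟨by simp, by simpa [degSum] using Nat.lt_of_succ_le hn.1, Nat.zero_le _⟩
    | succ j ih =>
      obtain ⟨hv, hlt, hle⟩ := ih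
      have hj : remainder s j ≠ 0 := fun h0 =>
        hn.2 (hankel_det_eq_zero_of_gap hv hlt (Or.inl h0))
      have hv' : ∀ i < j + 1, remainder s i ≠ 0 := by
        intro i hi
        rcases Nat.lt_succ_iff_lt_or_eq.1 hi with h | rfl
        · exact hv i h
        · exact hj
      have hge : ¬ n < degSum s (j + 1) := fun h0 =>
        hn.2 (hankel_det_eq_zero_of_gap hv hlt (Or.inr h0))
      have hne : n ≠ degSum s (j + 1) := by
        intro h0
        obtain ⟨i, hi, hi'⟩ := hcon _ h0
        exact hv' i hi hi'
      have := degSum_lt_degSum (lt_add_one j) hv'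
      exact ⟨hv', by omega, by omega⟩
  have := key n
  omega

theorem ncard_normalIndex_le {s : ℕ → ℝ} {j : ℕ} (h : ∀ i < j, remainder s i ≠ 0) :
    {m : ℕ | IsNormalIndex s m ∧ m ≤ degSum s j}.ncard = j := by
  have hset : {m : ℕ | IsNormalIndex s m ∧ m ≤ degSum s j} =
      degSum s '' (Finset.Icc 1 j : Finset ℕ) := by
    ext m
    simp only [Set.mem_ofPred_eq, Set.mem_image, Finset.coe_Icc, Set.mem_Icc]
    constructor
    · rintro ⟨hm, hle⟩
      obtain ⟨r, rfl, hr⟩ := exists_eq_degSum hm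
      refine ⟨r, ⟨Nat.one_le_iff_ne_zero.2 ?_, ?_⟩, rfl⟩
      · rintro rfl
        exact absurd hm.1 (by simp [degSum])
      · by_contra! hlt
        exact absurd (degSum_lt_degSum hlt hr) (by omega)
    · rintro ⟨r, ⟨h1, hrj⟩, rfl⟩
      have hr : ∀ i < r, remainder s i ≠ 0 := fun i hi => h i (by omega)
      exact ⟨⟨Nat.succ_le_of_lt ((Nat.zero_le _).trans_lt (degSum_lt_degSum h1 hr)),
        hankel_det_degSum_ne_zero hr⟩, degSum_mono s hrj⟩
  rw [hset, Set.InjOn.ncard_image, Set.ncard_coe_finset, Nat.card_Icc, Nat.add_sub_cancel]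
  intro a ha b hb hab
  rw [Finset.coe_Icc, Set.mem_Icc] at ha hb
  rcases lt_trichotomy a b with hlt | heq | hlt
  · have := degSum_lt_degSum hlt fun i hi => h i (by omega)
    omega
  · exact heq
  · have := degSum_lt_degSum hlt fun i hi => h i (by omega)
    omega

theorem IsNthNormalIndex.eq_degSum {s : ℕ → ℝ} {j n : ℕ} (hn : IsNthNormalIndex s j n) :
    n = degSum s j ∧ ∀ i < j, remainder s i ≠ 0 := by
  obtain ⟨r, rfl, hr⟩ := exists_eq_degSum hn.1
  have h := hn.2
  rw [ncard_normalIndex_le hr] at h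
  subst h
  exact ⟨rfl, hr⟩

/-- If `P_j = X p`, the orthogonality of `P_j` makes `p` a kernel vector of the shifted Hankel
matrix of size `deg P_j`. -/
theorem eval_zero_recSol_ne_zero {s : ℕ → ℝ} {j : ℕ} (h : ∀ i < j, remainder s i ≠ 0)
    (hdet : (hankel (shift s) (degSum s j)).det ≠ 0) : (recSol s 0 1 (j + 1)).eval 0 ≠ 0 := by
  intro h0
  obtain ⟨hmonic, hPdeg, -⟩ := recSol_first_degree h
  obtain ⟨p, hp⟩ := X_dvd_iff.2 ((coeff_zero_eq_eval_zero _).trans h0)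
  have hp0 : p ≠ 0 := by
    rintro rfl
    exact hmonic.ne_zero (by rw [hp, mul_zero])
  have hdeg : p.natDegree < degSum s j := by
    rw [hp, natDegree_X_mul hp0] at hPdeg
    omega
  refine hdet ((hankel_det_eq_zero_iff _ _).2 ⟨p, hp0, hdeg, fun i hi => ?_⟩)
  have := le_orderTop_iff.1 (degSum_add_one_le_orderTop_linError s j) ((i : ℤ) + 1) (by omega)
  rw [linError, HahnSeries.coeff_add, coeff_aeval_zSeries_pos _ (by omega), add_zero, hp] at this
  rw [coeff_aeval_mul_momentSeries_shift, this]

/-! ### Padé approximants as quotients of polynomials in `1/z` -/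

open Filter Asymptotics Topology

theorem aeval_inv_eq_reflect {K : Type*} [Field K] [Algebra ℂ K] {x : K} (hx : x ≠ 0) {A : ℂ[X]}
    {N : ℕ} (hA : A.natDegree ≤ N) :
    aeval x⁻¹ A = aeval x (reflect N A) * x⁻¹ ^ N := by
  let := invertibleOfNonzero (inv_ne_zero hx)
  have h := eval₂_reflect_mul_pow (algebraMap ℂ K) x⁻¹ N A hA
  rw [invOf_eq_inv, inv_inv] at h
  exact h.symm

theorem RatFunc_eval_div (p q : ℂ[X]) {z : ℂ} (hq : q.eval z ≠ 0) :
    (algebraMap ℂ[X] (RatFunc ℂ) p / algebraMap ℂ[X] (RatFunc ℂ) q).eval (RingHom.id ℂ) z =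
      p.eval z / q.eval z := by
  have hq0 : q ≠ 0 := by
    rintro rfl
    simp at hq
  set f := algebraMap ℂ[X] (RatFunc ℂ) p / algebraMap ℂ[X] (RatFunc ℂ) q with hf
  -- `RatFunc.eval` uses the reduced fraction, whose denominator divides `q`.
  have hd : f.denom.eval z ≠ 0 := by
    obtain ⟨r, hr⟩ := RatFunc.denom_div_dvd p q
    intro h0
    rw [← hf] at hr
    rw [hr, eval_mul, h0, zero_mul] at hq
    exact hq rfl
  have hcross : f.num * q = p * f.denom := by
    apply RatFunc.algebraMap_injective ℂ
    have hq' : algebraMap ℂ[X] (RatFunc ℂ) q ≠ 0 := RatFunc.algebraMap_ne_zero hq0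
    have hd' : algebraMap ℂ[X] (RatFunc ℂ) f.denom ≠ 0 :=
      RatFunc.algebraMap_ne_zero f.denom_ne_zero
    have := RatFunc.num_div_denom f
    rw [hf, div_eq_div_iff hd' hq', ← hf] at this
    rw [map_mul, map_mul, this]
  have := congrArg (eval z) hcross
  rw [eval_mul, eval_mul] at this
  rw [RatFunc.eval, ← eval, ← eval, div_eq_div_iff hd hq, this]

theorem RatFunc_eval_aeval_inv_div (A B : ℂ[X]) {z : ℂ} (hz : z ≠ 0) (hB : B.eval z⁻¹ ≠ 0) :
    (aeval (RatFunc.X : RatFunc ℂ)⁻¹ A / aeval (RatFunc.X : RatFunc ℂ)⁻¹ B).eval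
      (RingHom.id ℂ) z = A.eval z⁻¹ / B.eval z⁻¹ := by
  set N := max A.natDegree B.natDegree with hN
  have hX : (RatFunc.X : RatFunc ℂ) ≠ 0 := RatFunc.X_ne_zero
  have hA' := aeval_inv_eq_reflect hz (le_max_left A.natDegree B.natDegree)
  have hB' := aeval_inv_eq_reflect hz (le_max_right A.natDegree B.natDegree)
  rw [← hN, coe_aeval_eq_eval, coe_aeval_eq_eval] at hA' hB'
  have hz' : z⁻¹ ^ N ≠ 0 := pow_ne_zero _ (inv_ne_zero hz)
  have hBr : (reflect N B).eval z ≠ 0 := by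
    intro h0
    rw [hB', h0, zero_mul] at hB
    exact hB rfl
  rw [aeval_inv_eq_reflect hX (le_max_left A.natDegree B.natDegree),
    aeval_inv_eq_reflect hX (le_max_right A.natDegree B.natDegree), ← hN,
    mul_div_mul_right _ _ (pow_ne_zero _ (inv_ne_zero hX)), RatFunc.aeval_X_left_eq_algebraMap,
    RatFunc.aeval_X_left_eq_algebraMap, RatFunc_eval_div _ _ hBr, hA', hB',
    mul_div_mul_right _ _ hz']

/-- The polynomial `∑_{j < N} s_j w^{j+1}`. -/
def momentPoly (s : ℕ → ℝ) (N : ℕ) : ℝ[X] :=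
  X * ∑ j ∈ Finset.range N, monomial j (s j)

theorem eval_map_momentPoly_inv (s : ℕ → ℝ) (N : ℕ) (z : ℂ) :
    ((momentPoly s N).map (algebraMap ℝ ℂ)).eval z⁻¹ =
      ∑ j ∈ Finset.range N, (s j : ℂ) / z ^ (j + 1) := by
  rw [momentPoly, Polynomial.map_mul, Polynomial.map_sum, eval_mul, eval_finsetSum,
    Finset.mul_sum]
  refine Finset.sum_congr rfl fun j _ => ?_
  simp only [map_X, eval_X, map_monomial, eval_monomial, Complex.coe_algebraMap]
  rw [pow_succ', inv_pow]
  field_simp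

theorem eventually_cobounded_eval_inv_ne_zero {B : ℂ[X]} (hB : B.eval 0 ≠ 0) :
    ∀ᶠ z in Bornology.cobounded ℂ, z ≠ 0 ∧ B.eval z⁻¹ ≠ 0 := by
  have hcont : Tendsto (fun z : ℂ => B.eval z⁻¹) (Bornology.cobounded ℂ) (𝓝 (B.eval 0)) :=
    (B.continuous.tendsto 0).comp tendsto_inv₀_cobounded
  exact (Bornology.eventually_ne_cobounded 0).and (hcont.eventually_ne hB)

/-- The error equals `w^(L+M+1) H(w) / B(w)` with `H / B` bounded near `w = 0`, so the estimate
holds in a full neighbourhood of infinity. -/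
theorem isPade_of_dvd {s : ℕ → ℝ} {L M : ℕ} {A B : ℂ[X]} (hA : A.natDegree ≤ L)
    (hB : B.natDegree ≤ M) (hB0 : B.eval 0 ≠ 0)
    (hdvd : X ^ (L + M + 1) ∣ A + B * (momentPoly s (L + M + 1)).map (algebraMap ℝ ℂ)) :
    IsPade s L M (aeval (RatFunc.X : RatFunc ℂ)⁻¹ A / aeval (RatFunc.X : RatFunc ℂ)⁻¹ B) := by
  refine ⟨⟨A, B, hA, hB, hB0, rfl⟩, fun ε _ => ?_⟩
  refine IsBigO.mono ?_ (inf_le_left : sectorAtInfty ε ≤ Bornology.cobounded ℂ)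
  obtain ⟨H, hH⟩ := hdvd
  have hlim : Tendsto (fun z : ℂ => H.eval z⁻¹ / B.eval z⁻¹) (Bornology.cobounded ℂ)
      (𝓝 (H.eval 0 / B.eval 0)) :=
    ((H.continuous.tendsto 0).comp tendsto_inv₀_cobounded).div
      ((B.continuous.tendsto 0).comp tendsto_inv₀_cobounded) hB0
  have hO := (isBigO_refl (fun z : ℂ => 1 / z ^ (L + M + 1)) (Bornology.cobounded ℂ)).mul
    (hlim.isBigO_one ℂ)
  simp only [mul_one] at hO
  refine hO.congr' ?_ EventuallyEq.rfl
  filter_upwards [eventually_cobounded_eval_inv_ne_zero hB0] with z hz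
  rw [RatFunc_eval_aeval_inv_div A B hz.1 hz.2, ← eval_map_momentPoly_inv]
  have := congrArg (eval z⁻¹) hH
  simp only [eval_add, eval_mul, eval_pow, eval_X] at this
  rw [div_add' _ _ _ hz.2, mul_comm (eval z⁻¹ (Polynomial.map _ _)), this, one_div, inv_pow,
    mul_div_assoc]

/-- Write `D = w^m E` with `E(0) ≠ 0` and `m ≤ deg D < N`; the bound forces `E → 0` along `l`. Any
nontrivial approach to 0 suffices, in particular a single sector. -/
theorem eq_zero_of_isBigO_pow {l : Filter ℂ} [l.NeBot] (hl : l ≤ 𝓝[≠] 0) {D : ℂ[X]} {N : ℕ}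
    (hdeg : D.natDegree < N) (hO : (fun w => D.eval w) =O[l] fun w => w ^ N) : D = 0 := by
  by_contra hD
  obtain ⟨E, hE, hE0⟩ := exists_eq_pow_rootMultiplicity_mul_and_not_dvd D hD 0
  set m := D.rootMultiplicity 0
  rw [C_0, sub_zero] at hE hE0
  have hm : m < N := by
    refine lt_of_le_of_lt (natDegree_le_of_dvd (Dvd.intro _ hE.symm) hD |>.trans' ?_) hdeg
    simp
  have hEne : E.eval 0 ≠ 0 := by
    rwa [X_dvd_iff, coeff_zero_eq_eval_zero] at hE0
  have hl0 : Tendsto (fun w : ℂ => w) l (𝓝 0) := hl.trans inf_le_left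
  have hne : ∀ᶠ w in l, w ≠ 0 := hl self_mem_nhdsWithin
  have hE' : Tendsto (fun w => E.eval w) l (𝓝 (E.eval 0)) := (E.continuous.tendsto 0).comp hl0
  have hO' : (fun w => E.eval w) =O[l] fun w => w ^ (N - m) := by
    have := (isBigO_refl (fun w : ℂ => (w ^ m)⁻¹) l).mul hO
    refine this.congr' ?_ ?_
    · filter_upwards [hne] with w hw
      rw [hE, eval_mul, eval_pow, eval_X, inv_mul_cancel_left₀ (pow_ne_zero _ hw)]
    · filter_upwards [hne] with w hw
      rw [pow_sub₀ _ hw hm.le, mul_comm]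
  have hpow : Tendsto (fun w : ℂ => w ^ (N - m)) l (𝓝 0) := by
    have := hl0.pow (N - m)
    rwa [zero_pow (by omega)] at this
  exact hEne (tendsto_nhds_unique hE' (hO'.trans_tendsto hpow))

instance sectorAtInfty_one_neBot : (sectorAtInfty 1).NeBot := by
  -- The positive imaginary axis lies in the sector for `ε = 1`, since `1 < π/2`.
  have hray : Tendsto (fun t : ℝ => (t : ℂ) * Complex.I) atTop (sectorAtInfty 1) := by
    refine tendsto_inf.2 ⟨?_, tendsto_principal.2 ?_⟩
    · rw [← tendsto_norm_atTop_iff_cobounded]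
      simpa using tendsto_abs_atTop_atTop
    · filter_upwards [eventually_gt_atTop 0] with t ht
      rw [Complex.arg_real_mul _ ht, Complex.arg_I]
      have := Real.pi_gt_three
      constructor <;> linarith
  exact hray.neBot

theorem isPade_unique {s : ℕ → ℝ} {L M : ℕ} {f g : RatFunc ℂ} (hf : IsPade s L M f)
    (hg : IsPade s L M g) : f = g := by
  obtain ⟨⟨A, B, hA, hB, hB0, rfl⟩, hO⟩ := hf
  obtain ⟨⟨A', B', hA', hB', hB0', rfl⟩, hO'⟩ := hg
  set l := sectorAtInfty 1
  have hlc : l ≤ Bornology.cobounded ℂ := inf_le_left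
  have hdiff := (hO 1 one_pos).sub (hO' 1 one_pos)
  have hbdd : (fun z : ℂ => B.eval z⁻¹ * B'.eval z⁻¹) =O[l] fun _ => (1 : ℂ) :=
    ((((B.continuous.tendsto 0).comp tendsto_inv₀_cobounded).mul
      ((B'.continuous.tendsto 0).comp tendsto_inv₀_cobounded)).isBigO_one ℂ).mono hlc
  have hD : (fun z : ℂ => (A * B' - A' * B).eval z⁻¹) =O[l] fun z => z⁻¹ ^ (L + M + 1) := by
    refine (hbdd.mul hdiff).congr' ?_ (Eventually.of_forall fun z => ?_)
    · filter_upwards [hlc (eventually_cobounded_eval_inv_ne_zero hB0),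
        hlc (eventually_cobounded_eval_inv_ne_zero hB0')] with z hz hz'
      rw [RatFunc_eval_aeval_inv_div A B hz.1 hz.2, RatFunc_eval_aeval_inv_div A' B' hz.1 hz'.2,
        add_sub_add_right_eq_sub, eval_sub, eval_mul, eval_mul]
      rw [div_sub_div _ _ hz.2 hz'.2, mul_div_cancel₀ _ (mul_ne_zero hz.2 hz'.2)]
      ring
    · simp
  have hdeg : (A * B' - A' * B).natDegree < L + M + 1 := by
    refine Nat.lt_succ_of_le ((natDegree_sub_le _ _).trans (max_le ?_ ?_))
    · exact natDegree_mul_le.trans (add_le_add hA hB')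
    · exact natDegree_mul_le.trans (add_le_add hA' hB)
  have hzero : A * B' - A' * B = 0 := by
    refine eq_zero_of_isBigO_pow (l := map (fun z : ℂ => z⁻¹) l) ?_ hdeg ?_
    · exact (map_mono hlc).trans tendsto_inv₀_cobounded'
    · exact isBigO_map.2 hD
  -- If the value were 0, the quotient of `q` by itself would be `0 / 0 = 0`, yet it evaluates to 1
  -- near infinity.
  have hne : ∀ {q : ℂ[X]}, q.eval 0 ≠ 0 → aeval (RatFunc.X : RatFunc ℂ)⁻¹ q ≠ 0 := by
    intro q hq h0
    obtain ⟨z, hz0, hz⟩ := (eventually_cobounded_eval_inv_ne_zero hq).exists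
    have := RatFunc_eval_aeval_inv_div q q hz0 hz
    rw [h0, div_zero, RatFunc.eval_zero, div_self hz] at this
    exact zero_ne_one this
  rw [div_eq_div_iff (hne hB0) (hne hB0'), ← map_mul, ← map_mul, sub_eq_zero.1 hzero]

/-! ### From the order of the linearized error to the Padé property -/

theorem ofPowerSeries_reflect {p : ℝ[X]} {n : ℕ} (hp : p.natDegree ≤ n) :
    HahnSeries.ofPowerSeries ℤ ℝ (reflect n p : ℝ[X]) =
      HahnSeries.single (n : ℤ) (1 : ℝ) * aeval zSeries p := by
  ext k
  rw [HahnSeries.coeff_single_mul, one_mul]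
  by_cases hk : k < 0
  · rw [le_orderTop_iff.1 (le_orderTop_aeval_zSeries hp) _ (by omega)]
    exact (PowerSeries.coeff_coe _ k).trans (if_pos hk)
  · obtain ⟨i, rfl⟩ := Int.eq_ofNat_of_zero_le (not_lt.1 hk)
    rw [HahnSeries.ofPowerSeries_apply_coeff, Polynomial.coeff_coe, coeff_reflect]
    by_cases hi : i ≤ n
    · rw [revAt_le hi, show (i : ℤ) - n = -((n - i : ℕ) : ℤ) by omega, coeff_aeval_zSeries_neg]
    · rw [revAt_eq_self_of_lt (not_le.1 hi), coeff_aeval_zSeries_pos _ (by omega)]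
      exact coeff_eq_zero_of_natDegree_lt (by omega)

theorem le_orderTop_momentPoly_add_momentSeries (s : ℕ → ℝ) (N : ℕ) :
    ((N + 1 : ℤ) : WithTop ℤ) ≤ (HahnSeries.ofPowerSeries ℤ ℝ (momentPoly s N : ℝ[X]) +
      momentSeries s).orderTop := by
  rw [le_orderTop_iff, momentSeries, ← map_neg, ← map_add]
  intro k hk
  by_cases hk0 : k < 0
  · exact (PowerSeries.coeff_coe _ k).trans (if_pos hk0)
  · obtain ⟨i, rfl⟩ := Int.eq_ofNat_of_zero_le (not_lt.1 hk0)
    rw [HahnSeries.ofPowerSeries_apply_coeff, map_add, map_neg, Polynomial.coeff_coe, momentPoly]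
    cases i with
    | zero => simp
    | succ i =>
      rw [coeff_X_mul, PowerSeries.coeff_succ_X_mul, PowerSeries.coeff_mk]
      simp only [finsetSum_coeff, coeff_monomial]
      rw [Finset.sum_ite_eq' (Finset.range N) i, if_pos (Finset.mem_range.2 (by omega)),
        add_neg_cancel]

/-- Reflection multiplies by `w^n`, raising the order of `p F_0 - q` from `n` to `2n`. Truncating
the moment series costs only `w^n p · O(w^(2n+1))`, and `w^n p` has order at least 0. -/
theorem X_pow_dvd_reflect_add {s : ℕ → ℝ} {p q : ℝ[X]} {n : ℕ} (hp : p.natDegree ≤ n)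
    (hq : q.natDegree ≤ n) (h : ((n : ℤ) : WithTop ℤ) ≤
      (aeval zSeries p * momentSeries s - aeval zSeries q).orderTop) :
    X ^ (2 * n) ∣ reflect n q + reflect n p * momentPoly s (2 * n) := by
  rw [X_pow_dvd_iff]
  intro d hd
  set T := HahnSeries.ofPowerSeries ℤ ℝ (momentPoly s (2 * n) : ℝ[X])
  have hT := le_orderTop_momentPoly_add_momentSeries s (2 * n)
  set w : LaurentSeries ℝ := HahnSeries.single (n : ℤ) (1 : ℝ)
  have hw : ((n : ℤ) : WithTop ℤ) ≤ w.orderTop := HahnSeries.orderTop_single_le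
  have hE : HahnSeries.ofPowerSeries ℤ ℝ
      ((reflect n q + reflect n p * momentPoly s (2 * n) : ℝ[X]) : PowerSeries ℝ) =
      w * aeval zSeries p * (T + momentSeries s) -
        w * (aeval zSeries p * momentSeries s - aeval zSeries q) := by
    rw [Polynomial.coe_add, Polynomial.coe_mul, map_add, map_mul, ofPowerSeries_reflect hp,
      ofPowerSeries_reflect hq]
    ring
  rw [← Polynomial.coeff_coe, ← HahnSeries.ofPowerSeries_apply_coeff (Γ := ℤ), hE]
  refine (le_orderTop_iff (m := 2 * n)).1 (le_orderTop_sub ?_ ?_) _ (by exact_mod_cast hd)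
  · refine le_trans ?_
      (le_orderTop_mul (le_orderTop_mul hw (le_orderTop_aeval_zSeries hp)) hT)
    rw [WithTop.coe_le_coe]
    push_cast
    omega
  · refine le_trans ?_ (le_orderTop_mul hw h)
    rw [WithTop.coe_le_coe]
    omega

theorem toRat_eq_aeval_inv {p : ℝ[X]} {n : ℕ} (hp : p.natDegree ≤ n) :
    toRat p = aeval (RatFunc.X : RatFunc ℂ)⁻¹ ((reflect n p).map (algebraMap ℝ ℂ)) *
      RatFunc.X ^ n := by
  have hdeg : ((reflect n p).map (algebraMap ℝ ℂ)).natDegree ≤ n :=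
    natDegree_map_le.trans (natDegree_reflect_le.trans (max_le le_rfl hp))
  rw [aeval_inv_eq_reflect RatFunc.X_ne_zero hdeg, mul_assoc, ← mul_pow,
    inv_mul_cancel₀ RatFunc.X_ne_zero, one_pow, mul_one, reflect_map, reflect_reflect,
    RatFunc.aeval_X_left_eq_algebraMap, toRat]

theorem isPade_of_le_orderTop {s : ℕ → ℝ} {p q : ℝ[X]} {n : ℕ} (hn : 1 ≤ n)
    (hp : p.natDegree ≤ n) (hpn : p.coeff n ≠ 0) (hp0 : p.coeff 0 = 0) (hq : q.natDegree ≤ n)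
    (h : ((n : ℤ) : WithTop ℤ) ≤
      (aeval zSeries p * momentSeries s - aeval zSeries q).orderTop) :
    IsPade s n (n - 1) (toRat q / toRat p) := by
  rw [toRat_eq_aeval_inv hp, toRat_eq_aeval_inv hq,
    mul_div_mul_right _ _ (pow_ne_zero _ RatFunc.X_ne_zero)]
  have hN : n + (n - 1) + 1 = 2 * n := by omega
  refine isPade_of_dvd ?_ ?_ ?_ ?_
  · exact natDegree_map_le.trans (natDegree_reflect_le.trans (max_le le_rfl hq))
  · refine natDegree_map_le.trans ?_
    rw [natDegree_le_iff_coeff_eq_zero]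
    intro i hi
    rw [coeff_reflect]
    -- The top coefficient of the reflected `p` is `p.coeff 0 = 0`; this is where the denominator
    -- loses one degree.
    rcases (show n ≤ i by omega).eq_or_lt with rfl | hlt
    · rw [revAt_le le_rfl, Nat.sub_self, hp0]
    · rw [revAt_eq_self_of_lt hlt, coeff_eq_zero_of_natDegree_lt (by omega)]
  · rw [← coeff_zero_eq_eval_zero, coeff_map, coeff_reflect, revAt_le (Nat.zero_le n),
      Nat.sub_zero]
    exact (_root_.map_ne_zero _).2 hpn
  · rw [hN, ← Polynomial.map_mul, ← Polynomial.map_add, ← map_X (algebraMap ℝ ℂ),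
      ← Polynomial.map_pow]
    exact Polynomial.map_dvd _ (X_pow_dvd_reflect_add hp hq h)

/-! ### Generalized Stieltjes polynomials of odd index -/

theorem stieltjesP_odd (s : ℕ → ℝ) (i : ℕ) :
    stieltjesP s (2 * (i + 1) - 1) = -C (bTilde s i)⁻¹ *
      (recSol s 0 1 (i + 2) * C ((recSol s 0 1 (i + 1)).eval 0) -
        recSol s 0 1 (i + 1) * C ((recSol s 0 1 (i + 2)).eval 0)) := by
  have hodd : ¬ Even (2 * (i + 1) - 1) := by
    rw [Nat.even_iff]
    omega
  rw [stieltjesP, if_neg hodd, show (2 * (i + 1) - 1) / 2 = i by omega, Matrix.det_fin_two_of]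
  rfl

theorem stieltjesQ_odd (s : ℕ → ℝ) (i : ℕ) :
    stieltjesQ s (2 * (i + 1) - 1) = C (bTilde s i)⁻¹ *
      (recSol s (-1) 0 (i + 2) * C ((recSol s 0 1 (i + 1)).eval 0) -
        recSol s (-1) 0 (i + 1) * C ((recSol s 0 1 (i + 2)).eval 0)) := by
  have hodd : ¬ Even (2 * (i + 1) - 1) := by
    rw [Nat.even_iff]
    omega
  rw [stieltjesQ, if_neg hodd, show (2 * (i + 1) - 1) / 2 = i by omega, Matrix.det_fin_two_of]
  rfl

theorem natDegree_C_mul_sub_le (c a b : ℝ) {p q : ℝ[X]} {n : ℕ} (hp : p.natDegree ≤ n)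
    (hq : q.natDegree ≤ n) : (C c * (p * C a - q * C b)).natDegree ≤ n :=
  (natDegree_C_mul_le _ _).trans <| (natDegree_sub_le _ _).trans <|
    max_le ((natDegree_mul_C_le _ _).trans hp) ((natDegree_mul_C_le _ _).trans hq)

theorem le_orderTop_stieltjes (s : ℕ → ℝ) (i : ℕ) :
    ((degSum s (i + 1) : ℤ) : WithTop ℤ) ≤
      (aeval zSeries (stieltjesP s (2 * (i + 1) - 1)) * momentSeries s -
        aeval zSeries (stieltjesQ s (2 * (i + 1) - 1))).orderTop := by
  have hC : ∀ c : ℝ, ((0 : ℤ) : WithTop ℤ) ≤ (aeval zSeries (C c)).orderTop := fun c =>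
    le_orderTop_aeval_zSeries (d := 0) (natDegree_C c).le
  have hE : aeval zSeries (stieltjesP s (2 * (i + 1) - 1)) * momentSeries s -
        aeval zSeries (stieltjesQ s (2 * (i + 1) - 1)) =
      aeval zSeries (C (bTilde s i)⁻¹) *
        (aeval zSeries (C ((recSol s 0 1 (i + 2)).eval 0)) * linError s (i + 1) -
          aeval zSeries (C ((recSol s 0 1 (i + 1)).eval 0)) * linError s (i + 2)) := by
    rw [stieltjesP_odd, stieltjesQ_odd, linError, linError]
    simp only [map_mul, map_sub, map_neg]
    ring
  rw [hE]
  -- The earlier error `linError s (i + 1)` already has the required order and limits the estimate.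
  have h1 := le_orderTop_mul (hC ((recSol s 0 1 (i + 2)).eval 0)) (le_orderTop_linError s (i + 1))
  have h2 := le_orderTop_mul (hC ((recSol s 0 1 (i + 1)).eval 0))
    (((WithTop.coe_le_coe.2 (Int.ofNat_le.2 (degSum_mono s (Nat.le_succ (i + 1)))))).trans
      (le_orderTop_linError s (i + 2)))
  have h3 := le_orderTop_mul (hC (bTilde s i)⁻¹) (le_orderTop_sub h1 h2)
  simpa only [zero_add] using h3

/-- Only the monic `P_{i+1}` reaches this degree, so the coefficient is `-P_i(0) / b̃_i`. -/
theorem coeff_stieltjesP_odd_ne_zero {s : ℕ → ℝ} {i : ℕ}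
    (h : ∀ r < i + 1, remainder s r ≠ 0) (h0 : (recSol s 0 1 (i + 1)).eval 0 ≠ 0) :
    (stieltjesP s (2 * (i + 1) - 1)).coeff (degSum s (i + 1)) ≠ 0 := by
  obtain ⟨hm, hd, -⟩ := recSol_first_degree h
  obtain ⟨-, hd', -⟩ := recSol_first_degree fun r (hr : r < i) => h r (hr.trans (lt_add_one i))
  have hlead : (recSol s 0 1 (i + 2)).coeff (degSum s (i + 1)) = 1 := by
    rw [← hd]
    exact hm
  have hlow : (recSol s 0 1 (i + 1)).coeff (degSum s (i + 1)) = 0 :=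
    coeff_eq_zero_of_natDegree_lt (hd'.trans_lt (degSum_lt_degSum (lt_add_one i) h))
  rw [stieltjesP_odd, neg_mul, coeff_neg, coeff_C_mul, coeff_sub, coeff_mul_C, coeff_mul_C, hlead,
    hlow, one_mul, zero_mul, sub_zero]
  exact neg_ne_zero.2 (mul_ne_zero (inv_ne_zero (prod_atomB_ne_zero h)) h0)

end StieltjesPade

end

theorem mainTheorem4 (κ k : ℕ) (s : ℕ → ℝ) (hs : StieltjesPade.ClassHReg κ k s)
    (j n : ℕ) (hn : StieltjesPade.IsNthNormalIndex s j n) :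
    StieltjesPade.stieltjesP s (2 * j - 1) ≠ 0 ∧
    StieltjesPade.IsPade s n (n - 1)
      (StieltjesPade.toRat (StieltjesPade.stieltjesQ s (2 * j - 1)) /
        StieltjesPade.toRat (StieltjesPade.stieltjesP s (2 * j - 1))) ∧
    ∀ f : RatFunc ℂ, StieltjesPade.IsPade s n (n - 1) f →
      f = StieltjesPade.toRat (StieltjesPade.stieltjesQ s (2 * j - 1)) /
        StieltjesPade.toRat (StieltjesPade.stieltjesP s (2 * j - 1)) := by
  open StieltjesPade in
  obtain ⟨rfl, hv⟩ := hn.eq_degSum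
  have hpos : 1 ≤ degSum s j := hn.1.1
  obtain ⟨i, rfl⟩ : ∃ i, j = i + 1 := Nat.exists_eq_succ_of_ne_zero <| by
    rintro rfl
    simp [degSum] at hpos
  have hv' : ∀ r < i, remainder s r ≠ 0 := fun r hr => hv r (hr.trans (lt_add_one i))
  have h0 : (recSol s 0 1 (i + 1)).eval 0 ≠ 0 := by
    -- Regularity speaks of indices `n ≥ 1` only; for `i = 0` the polynomial is `P_0 = 1`.
    rcases Nat.eq_zero_or_pos i with rfl | hi
    · simp [recSol]
    · exact eval_zero_recSol_ne_zero hv' (hs.2.2 _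
        ⟨(Nat.zero_le _).trans_lt (degSum_lt_degSum hi hv'), hankel_det_degSum_ne_zero hv'⟩)
  have hcoeff := coeff_stieltjesP_odd_ne_zero hv h0
  obtain ⟨-, hPdeg, hPdeg'⟩ := recSol_first_degree hv
  obtain ⟨hQdeg, hQdeg'⟩ := natDegree_recSol_second_le s (i + 1)
  have hPade : IsPade s (degSum s (i + 1)) (degSum s (i + 1) - 1)
      (toRat (stieltjesQ s (2 * (i + 1) - 1)) / toRat (stieltjesP s (2 * (i + 1) - 1))) := by
    refine isPade_of_le_orderTop hpos ?_ hcoeff ?_ ?_ (le_orderTop_stieltjes s i)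
    · rw [stieltjesP_odd, ← Polynomial.C_neg]
      exact natDegree_C_mul_sub_le _ _ _ hPdeg.le hPdeg'
    -- At `z = 0` the two rows of the determinant coincide.
    · rw [stieltjesP_odd, Polynomial.coeff_zero_eq_eval_zero]
      simp only [Polynomial.eval_mul, Polynomial.eval_sub, Polynomial.eval_C]
      ring
    · rw [stieltjesQ_odd]
      exact natDegree_C_mul_sub_le _ _ _ hQdeg hQdeg'
  refine ⟨fun h => hcoeff (by rw [h, Polynomial.coeff_zero]), hPade, fun f hf => ?_⟩
  exact isPade_unique hf hPade
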